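/- For $h\in\mathbb{R}^d$ put $(\Delta_h g)(x)=g(x+h)-g(x)$, and let $\Delta_h^m$ be its $m$-th iterate. Let $C(\mathbb{R}^d)$ be the complex vector space of continuous functions $\mathbb{R}^d\to\mathbb{C}$. A continuous exponential polynomial on $\mathbb{R}^d$ is a finite sum $x\mapsto\sum_j p_j(x)\,e^{\langle\mu_j,x\rangle}$, where the $p_j$ are polynomials in $x_1,\dots,x_d$ with complex coefficients, $\mu_j\in\mathbb{C}^d$ and $\langle\mu,x\rangle=\sum_i\mu_i x_i$. **Theorem.** Let $d,t$ be positive integers, let $h_1,\dots,h_t\in\mathbb{R}^d$, and let $m_1,\dots,m_t\ge 1$ and $n_1,\dots,n_t\ge 0$ be integers. Let $H\subseteq C(\mathbb{R}^d)$ be a finite-dimensional linear subspace with $\Delta_{h_k}^{m_k}(H)\subseteq H$ for $k=1,\dots,t$, and let $f\in C(\mathbb{R}^d)$ satisfy $\Delta_{h_k}^{n_k}f\in H$ for $k=1,\dots,t$. Suppose that the closure of the additive subgroup $G$ of $\mathbb{R}^d$ generated by $h_1,\dots,h_t$ satisfies $\overline{G}=V\oplus\Lambda$ (that is, $\overline G=V+\Lambda$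 and $V\cap\Lambda=\{0\}$), where $V$ is a vector subspace of $\mathbb{R}^d$ and $\Lambda$ is a discrete additive subgroup of $\mathbb{R}^d$. Then for each $\lambda\in\Lambda$ there exists a continuous exponential polynomial $e_\lambda:\mathbb{R}^d\to\mathbb{C}$ such that $$f(x+\lambda)=e_\lambda(x)\quad\text{for all }x\in V.$$ If, moreover, $f$ is real-valued, then $e_\lambda$ can be chosen real-valued. -/

import Mathlib

/-- `e : ℝ^d → ℂ` is a continuous exponential polynomial: a finite sum of terms
`p(x) * exp (μ₁ x₁ + ⋯ + μ_d x_d)`, where `p` is a polynomial in the coordinates with complex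
coefficients and `μ ∈ ℂ^d`. -/
def IsExpPolynomial {d : ℕ} (e : EuclideanSpace ℝ (Fin d) → ℂ) : Prop :=
  ∃ (n : ℕ) (p : Fin n → MvPolynomial (Fin d) ℂ) (μ : Fin n → Fin d → ℂ),
    ∀ x : EuclideanSpace ℝ (Fin d),
      e x = ∑ j, MvPolynomial.eval (fun i => (x i : ℂ)) (p j) *
        Complex.exp (∑ i, μ j i * (x i : ℂ))

/-!
The operators `Δ_{h k}` commute, and for each `k` some nonzero polynomial in `Δ_{h k}` annihilates
`f`, since `Δ_{h k} ^ n k` maps `f` into a finite-dimensional space invariant under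
`Δ_{h k} ^ m k`. Hence `f` generates a finite-dimensional module `W` over the algebra spanned by
these operators. As `W` consists of continuous functions, the translations preserving it form a
closed group, which contains the closure of `G` and in particular `V`.

Let `π` be the orthogonal projection onto `V`. The functions `x ↦ g (π x + l)` with `g ∈ W` form a
finite-dimensional space of continuous functions invariant under all translations of `ℝ^d`. The
matrix of the translation by `x` on it is a continuous homomorphism in `x`, hence a product of
factors `exp (x i • a i)`, and on each generalized eigenspace of `a i` such a factor is a scalar
exponential times a polynomial in `x i`.
-/

section Annihilator

open Polynomial

variable {K M : Type*} [Field K] [AddCommGroup M] [Module K M]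

theorem finiteDimensional_span_singleton_of_aeval_smul_eq_zero {A : Type*} [CommRing A]
    [Algebra K A] [Module A M] [IsScalarTower K A M] {s : Set A} (hs : s.Finite)
    (hgen : Algebra.adjoin K s = ⊤) {f : M}
    (hf : ∀ x ∈ s, ∃ p : K[X], p ≠ 0 ∧ aeval x p • f = 0) :
    FiniteDimensional K (Submodule.span A {f}) := by
  let I := Ideal.torsionOf A M f
  let π : A →ₐ[K] A ⧸ I := Ideal.Quotient.mkₐ K I
  have integral : ∀ y ∈ π '' s, IsIntegral K y := by
    rintro _ ⟨x, hx, rfl⟩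
    obtain ⟨p, hp, hpf⟩ := hf x hx
    refine IsAlgebraic.isIntegral ⟨p, hp, ?_⟩
    rw [aeval_algHom_apply]
    exact Ideal.Quotient.eq_zero_iff_mem.2 ((Ideal.mem_torsionOf_iff f _).2 hpf)
  have adjoin_eq_top : Algebra.adjoin K (π '' s) = ⊤ := by
    rw [← AlgHom.map_adjoin, hgen, Algebra.map_top, AlgHom.range_eq_top]
    exact Ideal.Quotient.mkₐ_surjective K I
  have : Module.Finite K (A ⧸ I) := by
    have fg := fg_adjoin_of_finite (hs.image π) integral
    rw [adjoin_eq_top, Algebra.top_toSubmodule] at fg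
    exact ⟨fg⟩
  exact Module.Finite.equiv ((Ideal.quotTorsionOfEquivSpanSingleton A M f).restrictScalars K)

/-- The smallest subspace that contains `f` and is invariant under every operator of `s`: the
orbit of `f` under the algebra generated by `s`. -/
def cyclicSpan (s : Set (Module.End K M)) (f : M) : Submodule K M :=
  (Submodule.span (Algebra.adjoin K s) {f}).restrictScalars K

theorem mem_cyclicSpan_self (s : Set (Module.End K M)) (f : M) : f ∈ cyclicSpan s f :=
  Submodule.mem_span_singleton_self f

theorem cyclicSpan_mem_invtSubmodule {s : Set (Module.End K M)} {D : Module.End K M} (hD : D ∈ s)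
    (f : M) : cyclicSpan s f ∈ D.invtSubmodule := fun _ hg =>
  (Submodule.span (Algebra.adjoin K s) {f}).smul_mem ⟨D, Algebra.subset_adjoin hD⟩ hg

theorem cyclicSpan_le {s : Set (Module.End K M)} {f : M} {C : Submodule K M} (hf : f ∈ C)
    (hC : ∀ D ∈ s, C ∈ D.invtSubmodule) : cyclicSpan s f ≤ C := by
  intro g hg
  obtain ⟨⟨c, hc⟩, rfl⟩ := Submodule.mem_span_singleton.1 hg
  suffices C ∈ Module.End.invtSubmodule c from this hf
  clear hg
  induction hc using Algebra.adjoin_induction with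
  | mem D hD => exact hC D hD
  | algebraMap r => exact fun g hg => C.smul_mem r hg
  | add _ _ _ _ ha hb => exact fun g hg => C.add_mem (ha hg) (hb hg)
  | mul _ _ _ _ ha hb => exact fun g hg => ha (hb hg)

theorem finiteDimensional_cyclicSpan {s : Set (Module.End K M)} (hs : s.Finite)
    (hcomm : ∀ D ∈ s, ∀ E ∈ s, D * E = E * D) {f : M}
    (hf : ∀ D ∈ s, ∃ p : K[X], p ≠ 0 ∧ aeval D p f = 0) :
    FiniteDimensional K (cyclicSpan s f) := by
  have := Algebra.isMulCommutative_adjoin K hcomm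
  open scoped IsMulCommutative in
  refine finiteDimensional_span_singleton_of_aeval_smul_eq_zero
    (hs.preimage Subtype.val_injective.injOn) Algebra.adjoin_adjoin_coe_preimage fun D hD => ?_
  obtain ⟨p, hp, hpf⟩ := hf D hD
  refine ⟨p, hp, ?_⟩
  rwa [Subalgebra.smul_def, aeval_subalgebra_coe]

theorem aeval_restrict_apply {D : Module.End K M} {H : Submodule K M} (hH : ∀ x ∈ H, D x ∈ H)
    (p : K[X]) (x : H) : (aeval (D.restrict hH) p x : M) = aeval D p x := by
  induction p using Polynomial.induction_on' with
  | add p q hp hq => simp [hp, hq]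
  | monomial n a => simp [aeval_monomial, Module.End.pow_restrict n hH]

theorem exists_ne_zero_aeval_apply_eq_zero {D : Module.End K M} {H : Submodule K M}
    [FiniteDimensional K H] {m n : ℕ} (hm : 1 ≤ m) (hH : ∀ g ∈ H, (D ^ m) g ∈ H) {f : M}
    (hf : (D ^ n) f ∈ H) : ∃ p : K[X], p ≠ 0 ∧ aeval D p f = 0 := by
  let R : Module.End K H := (D ^ m).restrict hH
  have annihilates : aeval (D ^ m) (minpoly K R) ((D ^ n) f) = 0 := by
    rw [← aeval_restrict_apply hH _ ⟨_, hf⟩, minpoly.aeval]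
    rfl
  refine ⟨expand K m (minpoly K R) * X ^ n, mul_ne_zero ?_ (pow_ne_zero n X_ne_zero), ?_⟩
  · exact (expand_ne_zero hm).2 (minpoly.ne_zero (Algebra.IsIntegral.isIntegral R))
  · rw [map_mul, expand_aeval, map_pow, aeval_X]
    exact annihilates

end Annihilator

section OneParameterGroup

open NormedSpace Filter Topology
open scoped Nat

variable {𝔸 : Type*} [NormedRing 𝔸] [CompleteSpace 𝔸]

section Real

variable [NormedAlgebra ℝ 𝔸]

theorem exists_isUnit_intervalIntegral {T : ℝ → 𝔸} (hT : Continuous T) (h0 : IsUnit (T 0)) :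
    ∃ u, IsUnit (∫ s in (0 : ℝ)..u, T s) := by
  have slope_tendsto : Tendsto (fun u : ℝ => u⁻¹ • ∫ s in (0 : ℝ)..u, T s) (𝓝[≠] 0) (𝓝 (T 0)) := by
    simpa using (hT.integral_hasStrictDerivAt 0 0).hasDerivAt.tendsto_slope_zero
  obtain ⟨u, hu, hu0⟩ := ((slope_tendsto.eventually (Units.nhds h0.unit)).and
    self_mem_nhdsWithin).exists
  exact ⟨u, (isUnit_smul_iff (Units.mk0 u hu0)⁻¹ _).1 hu⟩

theorem mul_intervalIntegral_addChar {T : AddChar ℝ 𝔸} (hT : Continuous T) (t u : ℝ) :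
    T t * ∫ s in (0 : ℝ)..u, T s = ∫ s in t..(t + u), T s := calc
  T t * ∫ s in (0 : ℝ)..u, T s = ∫ s in (0 : ℝ)..u, T t * T s :=
    ((ContinuousLinearMap.mul ℝ 𝔸 (T t)).intervalIntegral_comp_comm
      (hT.intervalIntegrable _ _)).symm
  _ = ∫ s in t..(t + u), T s := by simp [← AddChar.map_add_eq_mul]

theorem differentiable_addChar {T : AddChar ℝ 𝔸} (hT : Continuous T) : Differentiable ℝ T := by
  let I : ℝ → 𝔸 := fun u => ∫ s in (0 : ℝ)..u, T s
  have I_diff : Differentiable ℝ I := fun u =>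
    (hT.integral_hasStrictDerivAt 0 u).hasDerivAt.differentiableAt
  obtain ⟨u, hu⟩ := exists_isUnit_intervalIntegral hT (by simp)
  have T_eq : ⇑T = fun t => (I (t + u) - I t) * ↑hu.unit⁻¹ := by
    funext t
    rw [Units.eq_mul_inv_iff_mul_eq, IsUnit.unit_spec, mul_intervalIntegral_addChar hT,
      intervalIntegral.integral_interval_sub_left] <;>
    exact hT.intervalIntegrable _ _
  rw [T_eq]
  fun_prop

theorem hasDerivAt_addChar {T : AddChar ℝ 𝔸} (hT : Continuous T) (t : ℝ) :
    HasDerivAt T (T t * deriv T 0) t := by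
  have deriv_at_zero : HasDerivAt T (deriv T 0) (t - t) := by
    simpa using (differentiable_addChar hT 0).hasDerivAt
  refine ((deriv_at_zero.comp_sub_const t t).const_mul (T t)).congr_of_eventuallyEq
    (.of_forall fun s => ?_)
  simp [← AddChar.map_add_eq_mul]

theorem addChar_eq_exp_smul {T : AddChar ℝ 𝔸} (hT : Continuous T) (t : ℝ) :
    T t = exp (t • deriv T 0) := by
  let : NormedAlgebra ℚ 𝔸 := NormedAlgebra.restrictScalars ℚ ℝ 𝔸
  set a := deriv T 0 with ha
  have deriv_eq_zero (s : ℝ) : HasDerivAt (fun s => T s * exp (s • -a)) 0 s := by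
    refine ((hasDerivAt_addChar hT s).mul (hasDerivAt_exp_smul_const' (-a) s)).congr_deriv ?_
    simp [ha, mul_assoc]
  have const : T t * exp (t • -a) = 1 := by
    simpa using is_const_of_deriv_eq_zero (fun s => (deriv_eq_zero s).differentiableAt)
      (fun s => (deriv_eq_zero s).deriv) t 0
  have cancel : exp (t • -a) * exp (t • a) = 1 := by
    rw [← exp_add_of_commute] <;> simp
  rw [← one_mul (exp _), ← const, mul_assoc, cancel, mul_one]

end Real

theorem exp_smul_mul_eq_sum [NormedAlgebra ℂ 𝔸] {a e : 𝔸} {μ : ℂ} {k : ℕ}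
    (h : (a - algebraMap ℂ 𝔸 μ) ^ k * e = 0) (t : ℂ) :
    exp (t • a) * e = Complex.exp (μ * t) •
      ∑ j ∈ Finset.range k, (t ^ j / j !) • ((a - algebraMap ℂ 𝔸 μ) ^ j * e) := by
  let : NormedAlgebra ℚ 𝔸 := NormedAlgebra.restrictScalars ℚ ℂ 𝔸
  set N := a - algebraMap ℂ 𝔸 μ with hN
  have split : t • a = algebraMap ℂ 𝔸 (μ * t) + t • N := by
    rw [hN, smul_sub, Algebra.smul_def t (algebraMap ℂ 𝔸 μ), ← map_mul, mul_comm t μ]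
    abel
  have vanish : ∀ j ∉ Finset.range k, ((j ! : ℂ)⁻¹ • (t • N) ^ j) * e = 0 := by
    intro j hj
    obtain ⟨i, rfl⟩ := Nat.exists_eq_add_of_le' (not_lt.1 (mt Finset.mem_range.2 hj))
    simp [smul_pow, pow_add, mul_assoc, h]
  have series : exp (t • N) * e = ∑ j ∈ Finset.range k, ((j ! : ℂ)⁻¹ • (t • N) ^ j) * e :=
    ((exp_series_hasSum_exp' (𝕂 := ℂ) (t • N)).mul_right e).unique
      (hasSum_sum_of_ne_finset_zero vanish)
  rw [split, exp_add_of_commute (Algebra.commutes _ _), ← algebraMap_exp_comm, mul_assoc, series,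
    ← Algebra.smul_def, ← Complex.exp_eq_exp_ℂ]
  simp only [smul_pow, smul_smul, smul_mul_assoc, div_eq_inv_mul]

end OneParameterGroup

section ExpPolynomial

variable {d : ℕ}

theorem isExpPolynomial_of_fintype {ι : Type*} [Fintype ι] {e : EuclideanSpace ℝ (Fin d) → ℂ}
    (p : ι → MvPolynomial (Fin d) ℂ) (μ : ι → Fin d → ℂ)
    (he : ∀ x, e x = ∑ j, MvPolynomial.eval (fun i => (x i : ℂ)) (p j) *
      Complex.exp (∑ i, μ j i * (x i : ℂ))) : IsExpPolynomial e := by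
  let σ := Fintype.equivFin ι
  refine ⟨Fintype.card ι, p ∘ σ.symm, μ ∘ σ.symm, fun x => ?_⟩
  rw [he x, ← σ.symm.sum_comp]
  rfl

theorem isExpPolynomial_eval_mul_exp (p : MvPolynomial (Fin d) ℂ) (μ : Fin d → ℂ) :
    IsExpPolynomial fun x : EuclideanSpace ℝ (Fin d) =>
      MvPolynomial.eval (fun i => (x i : ℂ)) p * Complex.exp (∑ i, μ i * (x i : ℂ)) :=
  isExpPolynomial_of_fintype (fun _ : Unit => p) (fun _ => μ) (by simp)

theorem IsExpPolynomial.add {e₁ e₂ : EuclideanSpace ℝ (Fin d) → ℂ} (h₁ : IsExpPolynomial e₁)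
    (h₂ : IsExpPolynomial e₂) : IsExpPolynomial (e₁ + e₂) := by
  obtain ⟨n₁, p₁, μ₁, h₁⟩ := h₁
  obtain ⟨n₂, p₂, μ₂, h₂⟩ := h₂
  exact isExpPolynomial_of_fintype (Sum.elim p₁ p₂) (Sum.elim μ₁ μ₂) fun x => by
    simp [h₁, h₂]

theorem IsExpPolynomial.mul {e₁ e₂ : EuclideanSpace ℝ (Fin d) → ℂ} (h₁ : IsExpPolynomial e₁)
    (h₂ : IsExpPolynomial e₂) : IsExpPolynomial (e₁ * e₂) := by
  obtain ⟨n₁, p₁, μ₁, h₁⟩ := h₁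
  obtain ⟨n₂, p₂, μ₂, h₂⟩ := h₂
  refine isExpPolynomial_of_fintype (fun j : Fin n₁ × Fin n₂ => p₁ j.1 * p₂ j.2)
    (fun j => μ₁ j.1 + μ₂ j.2) fun x => ?_
  rw [Pi.mul_apply, h₁, h₂, Fintype.sum_mul_sum, Fintype.sum_prod_type]
  refine Finset.sum_congr rfl fun a _ => Finset.sum_congr rfl fun b _ => ?_
  simp only [Pi.add_apply, add_mul, Finset.sum_add_distrib, Complex.exp_add, map_mul]
  ring

variable (d) in
/-- The algebra of continuous exponential polynomials on `ℝ^d`. -/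
def expPolynomial : Subalgebra ℂ (EuclideanSpace ℝ (Fin d) → ℂ) where
  carrier := {e | IsExpPolynomial e}
  add_mem' := IsExpPolynomial.add
  mul_mem' := IsExpPolynomial.mul
  algebraMap_mem' c := by
    simpa using! isExpPolynomial_eval_mul_exp (d := d) (MvPolynomial.C c) 0

theorem coord_mem_expPolynomial (i : Fin d) : (fun x => (x i : ℂ)) ∈ expPolynomial d := by
  simpa using! isExpPolynomial_eval_mul_exp (MvPolynomial.X i) 0

theorem exp_mul_coord_mem_expPolynomial (μ : ℂ) (i : Fin d) :
    (fun x => Complex.exp (μ * x i)) ∈ expPolynomial d := by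
  simpa [Pi.single_apply] using! isExpPolynomial_eval_mul_exp 1 (Pi.single i μ)

section Vector

variable {𝔸 : Type*}

/-- Vector-valued exponential polynomials: functions all of whose scalar components are exponential
polynomials. -/
def IsVectorExpPolynomial [AddCommMonoid 𝔸] [Module ℂ 𝔸] (F : EuclideanSpace ℝ (Fin d) → 𝔸) :
    Prop :=
  ∀ φ : Module.Dual ℂ 𝔸, (fun x => φ (F x)) ∈ expPolynomial d

theorem IsVectorExpPolynomial.mul [Ring 𝔸] [Algebra ℂ 𝔸] [FiniteDimensional ℂ 𝔸]
    {F G : EuclideanSpace ℝ (Fin d) → 𝔸} (hF : IsVectorExpPolynomial F)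
    (hG : IsVectorExpPolynomial G) : IsVectorExpPolynomial fun x => F x * G x := by
  intro φ
  let b := Module.finBasis ℂ 𝔸
  have expand : (fun x => φ (F x * G x)) =
      ∑ i, (fun x => b.coord i (F x)) * fun x => (φ ∘ₗ LinearMap.mulLeft ℂ (b i)) (G x) := by
    funext x
    conv_lhs => rw [← b.sum_repr (F x), Finset.sum_mul, map_sum]
    simp
  rw [expand]
  exact sum_mem fun i _ => mul_mem (hF _) (hG _)

theorem isVectorExpPolynomial_exp_coord_smul_mul [NormedRing 𝔸] [NormedAlgebra ℂ 𝔸]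
    [CompleteSpace 𝔸] {a e : 𝔸} {μ : ℂ} {k : ℕ} (h : (a - algebraMap ℂ 𝔸 μ) ^ k * e = 0)
    (i : Fin d) :
    IsVectorExpPolynomial fun x : EuclideanSpace ℝ (Fin d) =>
      NormedSpace.exp ((x i : ℂ) • a) * e := by
  intro φ
  have expand : (fun x : EuclideanSpace ℝ (Fin d) => φ (NormedSpace.exp ((x i : ℂ) • a) * e)) =
      (fun x => Complex.exp (μ * x i)) * ∑ j ∈ Finset.range k,
        (φ ((a - algebraMap ℂ 𝔸 μ) ^ j * e) / j.factorial) • (fun x => (x i : ℂ)) ^ j := by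
    funext x
    simp only [exp_smul_mul_eq_sum h, map_smul, map_sum, Pi.mul_apply, Finset.sum_apply,
      Pi.smul_apply, Pi.pow_apply, smul_eq_mul]
    congr! 2
    ring
  rw [expand]
  exact mul_mem (exp_mul_coord_mem_expPolynomial μ i) <| sum_mem fun j _ =>
    Subalgebra.smul_mem _ (pow_mem (coord_mem_expPolynomial i) j) _

theorem isVectorExpPolynomial_exp_coord_smul [NormedRing 𝔸] [NormedAlgebra ℂ 𝔸]
    [FiniteDimensional ℂ 𝔸] (a : 𝔸) (i : Fin d) :
    IsVectorExpPolynomial fun x : EuclideanSpace ℝ (Fin d) => NormedSpace.exp ((x i : ℂ) • a) := by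
  have := FiniteDimensional.complete ℂ 𝔸
  suffices ∀ e : 𝔸, IsVectorExpPolynomial fun x : EuclideanSpace ℝ (Fin d) =>
      NormedSpace.exp ((x i : ℂ) • a) * e by simpa using this 1
  intro e
  have e_mem : e ∈ ⨆ μ : ℂ, Module.End.maxGenEigenspace (LinearMap.mulLeft ℂ a) μ := by
    rw [Module.End.iSup_maxGenEigenspace_eq_top]
    trivial
  induction e_mem using Submodule.iSup_induction' with
  | mem μ e he =>
    obtain ⟨k, hk⟩ := (Module.End.mem_maxGenEigenspace _ _ _).1 he
    have shift : LinearMap.mulLeft ℂ a - μ • 1 = LinearMap.mulLeft ℂ (a - algebraMap ℂ 𝔸 μ) := by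
      ext y
      simp [sub_mul, Algebra.smul_def]
    rw [shift, LinearMap.pow_mulLeft] at hk
    exact isVectorExpPolynomial_exp_coord_smul_mul hk i
  | zero => exact fun φ => by simpa only [mul_zero, map_zero] using! zero_mem (expPolynomial d)
  | add e₁ e₂ _ _ h₁ h₂ => exact fun φ => by simpa [mul_add] using! add_mem (h₁ φ) (h₂ φ)

theorem isVectorExpPolynomial_addChar [NormedRing 𝔸] [NormedAlgebra ℂ 𝔸] [FiniteDimensional ℂ 𝔸]
    {T : AddChar (EuclideanSpace ℝ (Fin d)) 𝔸} (hT : Continuous T) : IsVectorExpPolynomial T := by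
  have := FiniteDimensional.complete ℂ 𝔸
  have axis (i : Fin d) : IsVectorExpPolynomial fun x : EuclideanSpace ℝ (Fin d) =>
      T (x i • EuclideanSpace.single i 1) := by
    let line := LinearMap.toSpanSingleton ℝ _ (EuclideanSpace.single i (1 : ℝ))
    let S : AddChar ℝ 𝔸 := T.compAddMonoidHom line.toAddMonoidHom
    have hS : Continuous S := hT.comp (LinearMap.continuous_of_finiteDimensional line)
    convert isVectorExpPolynomial_exp_coord_smul (deriv S 0) i with x
    rw [Complex.coe_smul, ← addChar_eq_exp_smul hS]
    rfl
  have partial_sum (s : Finset (Fin d)) : IsVectorExpPolynomial fun x : EuclideanSpace ℝ (Fin d) =>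
      T (∑ i ∈ s, x i • EuclideanSpace.single i 1) := by
    induction s using Finset.induction_on with
    | empty =>
      exact fun φ => by
        simpa only [Finset.sum_empty, AddChar.map_zero_eq_one] using!
          (expPolynomial d).algebraMap_mem (φ 1)
    | insert i s hi ih =>
      simp only [Finset.sum_insert hi, AddChar.map_add_eq_mul]
      exact (axis i).mul ih
  convert partial_sum Finset.univ with x
  ext j
  simp [Pi.single_apply]

end Vector

end ExpPolynomial

section StableSubspace

variable {E K M : Type*} [Field K] [AddCommGroup M] [Module K M]

theorem mem_invtSubmodule_of_mul_eq_one {A B : Module.End K M} (hBA : B * A = 1)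
    {W : Submodule K M} [FiniteDimensional K W] (hA : W ∈ A.invtSubmodule) :
    W ∈ B.invtSubmodule := by
  have leftInv (g : M) : B (A g) = g := LinearMap.congr_fun hBA g
  have inj : Function.Injective (A.restrict hA) := fun a b hab =>
    Subtype.ext <| Function.LeftInverse.injective leftInv (congrArg Subtype.val hab)
  intro g hg
  obtain ⟨g', hg'⟩ := LinearMap.injective_iff_surjective.1 inj ⟨g, hg⟩
  obtain rfl : A g' = g := congrArg Subtype.val hg'
  simp [leftInv]

/-- The stabilizer of a finite-dimensional subspace `W` under an action of an additive group by
linear operators. It is encoded by the inclusion `(ρ v) W ⊆ W`, which is an equality because `W` is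
finite-dimensional and `ρ v` is invertible. -/
def invtStabilizer [AddGroup E] (ρ : AddChar E (Module.End K M)) (W : Submodule K M)
    [FiniteDimensional K W] : AddSubgroup E where
  carrier := {v | W ∈ (ρ v).invtSubmodule}
  zero_mem' := by simp
  add_mem' hv hw := by
    simpa only [Set.mem_ofPred_eq, AddChar.map_add_eq_mul] using!
      Module.End.invtSubmodule.comp _ hv hw
  neg_mem' hv := mem_invtSubmodule_of_mul_eq_one (by simp [← AddChar.map_add_eq_mul]) hv

/-- The action induced by `ρ` on an invariant subspace `W`. -/
def restrictAddChar [AddMonoid E] (ρ : AddChar E (Module.End K M)) (W : Submodule K M)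
    (hW : ∀ v, W ∈ (ρ v).invtSubmodule) : AddChar E (Module.End K W) where
  toFun v := (ρ v).restrict (hW v)
  map_zero_eq_one' := by ext; simp
  map_add_eq_mul' v w := by
    ext g
    exact LinearMap.congr_fun (ρ.map_add_eq_mul v w) g

end StableSubspace

section Translation

variable (K : Type*) {E : Type*}

/-- The action of `E` on scalar functions by translations, `translation K v g x = g (x + v)`. -/
def translation [Semiring K] [AddMonoid E] : AddChar E (Module.End K (E → K)) where
  toFun v := LinearMap.funLeft K K (· + v)
  map_zero_eq_one' := by ext; simp [LinearMap.funLeft_apply]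
  map_add_eq_mul' v w := by ext; simp [LinearMap.funLeft_apply, add_assoc]

@[simp]
theorem translation_apply [Semiring K] [AddMonoid E] (v : E) (g : E → K) (x : E) :
    translation K v g x = g (x + v) :=
  rfl

variable {K}

theorem translation_sub_one_pow_apply [Ring K] [AddCommMonoid E] (v : E) (k : ℕ) (g : E → K) :
    ((translation K v - 1) ^ k) g = (fwdDiff v)^[k] g := by
  rw [Module.End.pow_apply]
  rfl

theorem commute_translation [Semiring K] [AddCommMonoid E] (v w : E) :
    Commute (translation K v) (translation K w) := by
  rw [Commute, SemiconjBy, ← AddChar.map_add_eq_mul, add_comm, AddChar.map_add_eq_mul]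

theorem map_funLeft_mem_invtSubmodule_translation {F : Type*} [Semiring K] [AddMonoid F]
    [AddCommMonoid E] (π : F →+ E) (l : E) {v : F} {W : Submodule K (E → K)}
    (hW : W ∈ (translation K (π v)).invtSubmodule) :
    W.map (LinearMap.funLeft K K fun x => π x + l) ∈ (translation K v).invtSubmodule := by
  rintro _ ⟨g, hg, rfl⟩
  refine ⟨translation K (π v) g, hW hg, ?_⟩
  ext x
  simp [LinearMap.funLeft_apply, add_right_comm]

theorem continuous_translation_apply [Semiring K] [TopologicalSpace K] [AddMonoid E]
    [TopologicalSpace E] [ContinuousAdd E] {g : E → K} (hg : Continuous g) :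
    Continuous fun v => translation K v g :=
  continuous_pi fun _ => hg.comp (continuous_const.add continuous_id')

theorem isClosed_invtStabilizer_translation [NontriviallyNormedField K] [CompleteSpace K]
    [AddGroup E] [TopologicalSpace E] [ContinuousAdd E] {W : Submodule K (E → K)}
    [FiniteDimensional K W] (hW : ∀ g ∈ W, Continuous g) :
    IsClosed (invtStabilizer (translation K) W : Set E) := by
  have eq_biInter : (invtStabilizer (translation K) W : Set E) =
      ⋂ g ∈ W, (fun v => translation K v g) ⁻¹' (W : Set (E → K)) := by
    ext v
    simp [invtStabilizer, Module.End.mem_invtSubmodule, SetLike.le_def]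
  rw [eq_biInter]
  exact isClosed_biInter fun g hg =>
    W.closed_of_finiteDimensional.preimage (continuous_translation_apply (hW g hg))

end Translation

open scoped Matrix.Norms.Operator in
/-- A theorem of Anselone and Korevaar. -/
theorem isExpPolynomial_of_forall_mem_invtSubmodule {d : ℕ}
    {W : Submodule ℂ (EuclideanSpace ℝ (Fin d) → ℂ)} [FiniteDimensional ℂ W]
    (hWcont : ∀ g ∈ W, Continuous g) (hW : ∀ v, W ∈ (translation ℂ v).invtSubmodule)
    {g : EuclideanSpace ℝ (Fin d) → ℂ} (hg : g ∈ W) : IsExpPolynomial g := by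
  let b := Module.finBasis ℂ W
  let ρ := restrictAddChar (translation ℂ) W hW
  let T := (LinearMap.toMatrixAlgEquiv b).toAlgHom.toMonoidHom.compAddChar ρ
  have hT : Continuous T := by
    refine continuous_matrix fun i j => ?_
    have column_continuous : Continuous fun v => ρ v (b j) :=
      (continuous_translation_apply (hWcont _ (b j).2)).subtype_mk _
    simpa [T, LinearMap.toMatrixAlgEquiv_apply] using!
      (LinearMap.continuous_of_finiteDimensional (b.coord i)).comp column_continuous
  let evalZero : Module.Dual ℂ (Module.End ℂ W) :=
    LinearMap.proj 0 ∘ₗ W.subtype ∘ₗ LinearMap.applyₗ ⟨g, hg⟩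
  have evalZero_apply (x : EuclideanSpace ℝ (Fin d)) : evalZero (ρ x) = g x :=
    congrArg g (zero_add x)
  have := isVectorExpPolynomial_addChar hT
    (evalZero ∘ₗ (LinearMap.toMatrixAlgEquiv b).symm.toLinearMap)
  simpa [T, evalZero_apply] using! this

theorem isExpPolynomial_comp_add_of_forall_mem_invtStabilizer {d : ℕ}
    {W : Submodule ℂ (EuclideanSpace ℝ (Fin d) → ℂ)} [FiniteDimensional ℂ W]
    (hWcont : ∀ g ∈ W, Continuous g)
    {π : EuclideanSpace ℝ (Fin d) →ₗ[ℝ] EuclideanSpace ℝ (Fin d)}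
    (hπ : ∀ v, π v ∈ invtStabilizer (translation ℂ) W) {g : EuclideanSpace ℝ (Fin d) → ℂ}
    (hg : g ∈ W) (l : EuclideanSpace ℝ (Fin d)) : IsExpPolynomial fun x => g (π x + l) := by
  refine isExpPolynomial_of_forall_mem_invtSubmodule
    (W := W.map (LinearMap.funLeft ℂ ℂ fun x => π x + l)) ?_
    (fun v => map_funLeft_mem_invtSubmodule_translation π.toAddMonoidHom l (hπ v))
    (Submodule.mem_map_of_mem hg)
  rintro _ ⟨g', hg', rfl⟩
  exact (hWcont g' hg').comp (π.continuous_of_finiteDimensional.add_const l)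

theorem exists_finiteDimensional_translation_invariant {K E ι : Type*} [Field K]
    [TopologicalSpace K] [IsTopologicalRing K] [AddCommMonoid E] [TopologicalSpace E]
    [ContinuousAdd E] [Finite ι] {h : ι → E} {n m : ι → ℕ} (hm : ∀ k, 1 ≤ m k)
    {H : ι → Submodule K (E → K)} (hHfin : ∀ k, FiniteDimensional K (H k))
    (hHinv : ∀ k, ∀ g ∈ H k, (fwdDiff (h k))^[m k] g ∈ H k) {f : E → K} (hf : Continuous f)
    (hfH : ∀ k, (fwdDiff (h k))^[n k] f ∈ H k) :
    ∃ W : Submodule K (E → K), FiniteDimensional K W ∧ f ∈ W ∧ (∀ g ∈ W, Continuous g) ∧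
      ∀ k, W ∈ (translation K (h k)).invtSubmodule := by
  let D (k : ι) : Module.End K (E → K) := translation K (h k) - 1
  have D_comm (i j : ι) : Commute (D i) (D j) :=
    ((commute_translation _ _).sub_left (Commute.one_left _)).sub_right (Commute.one_right _)
  have D_algebraic (k : ι) : ∃ p : Polynomial K, p ≠ 0 ∧ Polynomial.aeval (D k) p f = 0 := by
    have := hHfin k
    refine exists_ne_zero_aeval_apply_eq_zero (H := H k) (hm k) (fun g hg => ?_) (n := n k) ?_
    · simpa only [D, translation_sub_one_pow_apply] using hHinv k g hg
    · simpa only [D, translation_sub_one_pow_apply] using hfH k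
  let C : Submodule K (E → K) :=
    { carrier := {g | Continuous g}
      zero_mem' := continuous_zero
      add_mem' := Continuous.add
      smul_mem' := fun c _ hg => hg.const_smul c }
  have C_invariant (k : ι) : C ∈ (D k).invtSubmodule := fun g (hg : Continuous g) =>
    (hg.comp (continuous_add_const (h k))).sub hg
  refine ⟨cyclicSpan (Set.range D) f, ?_, mem_cyclicSpan_self _ f, ?_, fun k g hg => ?_⟩
  · exact finiteDimensional_cyclicSpan (Set.finite_range D)
      (Set.forall_mem_range.2 fun i => Set.forall_mem_range.2 fun j => D_comm i j)
      (Set.forall_mem_range.2 D_algebraic)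
  · exact cyclicSpan_le (C := C) hf (Set.forall_mem_range.2 C_invariant)
  · have eq_add : translation K (h k) g = D k g + g := by simp [D]
    rw [Submodule.mem_comap, eq_add]
    exact add_mem (cyclicSpan_mem_invtSubmodule (Set.mem_range_self k) f hg) hg

theorem mainTheorem3_general {d : ℕ} {ι : Type*} [Finite ι] (h : ι → EuclideanSpace ℝ (Fin d))
    (n m : ι → ℕ) (hm : ∀ k, 1 ≤ m k)
    (H : ι → Submodule ℂ (EuclideanSpace ℝ (Fin d) → ℂ))
    (hHfin : ∀ k, FiniteDimensional ℂ (H k))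
    (hHinv : ∀ k, ∀ g ∈ H k, (fwdDiff (h k))^[m k] g ∈ H k)
    (f : EuclideanSpace ℝ (Fin d) → ℂ) (hf : Continuous f)
    (hfH : ∀ k, (fwdDiff (h k))^[n k] f ∈ H k)
    (V : Submodule ℝ (EuclideanSpace ℝ (Fin d)))
    (hV : V.toAddSubgroup ≤ (AddSubgroup.closure (Set.range h)).topologicalClosure)
    (l : EuclideanSpace ℝ (Fin d)) :
    ∃ e : EuclideanSpace ℝ (Fin d) → ℂ,
      IsExpPolynomial e ∧ (∀ x ∈ V, f (x + l) = e x) ∧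
        ((∀ x, (f x).im = 0) → ∀ x, (e x).im = 0) := by
  obtain ⟨W, hWfin, hfW, hWcont, hW⟩ :=
    exists_finiteDimensional_translation_invariant hm hHfin hHinv hf hfH
  have closure_le : (AddSubgroup.closure (Set.range h)).topologicalClosure ≤
      invtStabilizer (translation ℂ) W :=
    AddSubgroup.topologicalClosure_minimal _
      ((AddSubgroup.closure_le _).2 (Set.range_subset_iff.2 hW))
      (isClosed_invtStabilizer_translation hWcont)
  have proj_mem (v : EuclideanSpace ℝ (Fin d)) :
      V.starProjection v ∈ invtStabilizer (translation ℂ) W :=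
    closure_le (hV (V.starProjection_apply_mem v))
  refine ⟨fun x => f (V.starProjection x + l), ?_, fun x hx => ?_, fun hreal x => hreal _⟩
  · exact isExpPolynomial_comp_add_of_forall_mem_invtStabilizer hWcont
      (π := V.starProjection.toLinearMap) proj_mem hfW l
  · simp only [Submodule.starProjection_eq_self_iff.2 hx]

theorem mainTheorem3 {d t : ℕ} (h : Fin t → EuclideanSpace ℝ (Fin d))
    (n m : Fin t → ℕ) (hm : ∀ k, 1 ≤ m k)
    (H : Submodule ℂ (EuclideanSpace ℝ (Fin d) → ℂ))
    (hHcont : ∀ g ∈ H, Continuous g)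
    (hHfin : FiniteDimensional ℂ H)
    (hHinv : ∀ k, ∀ g ∈ H, (fwdDiff (h k))^[m k] g ∈ H)
    (f : EuclideanSpace ℝ (Fin d) → ℂ) (hf : Continuous f)
    (hfH : ∀ k, (fwdDiff (h k))^[n k] f ∈ H)
    (V : Submodule ℝ (EuclideanSpace ℝ (Fin d)))
    (Λ : AddSubgroup (EuclideanSpace ℝ (Fin d))) (hΛ : DiscreteTopology Λ)
    (hsum : (AddSubgroup.closure (Set.range h)).topologicalClosure = V.toAddSubgroup ⊔ Λ)
    (hdirect : Disjoint V.toAddSubgroup Λ) :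
    ∀ l ∈ Λ, ∃ e : EuclideanSpace ℝ (Fin d) → ℂ,
      IsExpPolynomial e ∧ (∀ x ∈ V, f (x + l) = e x) ∧
        ((∀ x, (f x).im = 0) → ∀ x, (e x).im = 0) :=
  fun l _ => mainTheorem3_general h n m hm (fun _ => H) (fun _ => hHfin) hHinv f hf hfH V
    (hsum ▸ le_sup_left) l
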